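/- Let $n$ be a positive integer, let $S_n$ be the group of permutations of $\{1,\dots,n\}$, and let $f:S_n\to\mathbb{R}$ be a function of one of the following two forms: either $$f(\sigma)=\langle B,\sigma(A)\rangle=\sum_{i,j=1}^n b_{\sigma(i)\sigma(j)}\,a_{ij}$$ for some real $n\times n$ matrices $A=(a_{ij})$ and $B=(b_{ij})$, where $\sigma(A)$ is the matrix whose $(\sigma(i),\sigma(j))$ entry is $a_{ij}$ and $\langle X,Y\rangle=\sum_{i,j}x_{ij}y_{ij}$; or, more generally, $$f(\sigma)=\sum_{i,j=1}^n c^{ij}_{\sigma(i)\sigma(j)}$$ for some array $(c^{ij}_{kl})_{1\le i,j,k,l\le n}$ of real numbers. Let $\overline f=\frac1{n!}\sum_{\sigma\in S_n}f(\sigma)$, let $f_0=f-\overline f$, and let $\tau\in S_n$ satisfy $f_0(\tau)=\max_{\sigma\in S_n}f_0(\sigma)$. Let $k$ be an integer with $3\le k\le n-5$, let $0<\gamma<1$ be a real number, and put $$\beta(n,k)=\frac{k-2}{n^2-nk+k-2}.$$ Then a uniformly random permutation $\sigma\in S_n$ satisfies $$f_0(\sigma)\ge\gamma\,\beta(n,k)\,f_0(\tau)$$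 with probability at least $$\frac{(1-\gamma)\,\beta(n,k)}{5\,k!}.$$ -/

import Mathlib

noncomputable section

namespace QAP

/-- The action of `S_n` on real `n × n` matrices by simultaneous permutation of rows and columns:
`(permMat σ A) (σ i) (σ j) = A i j`. -/
def permMat {n : ℕ} (σ : Equiv.Perm (Fin n)) (A : Matrix (Fin n) (Fin n) ℝ) :
    Matrix (Fin n) (Fin n) ℝ :=
  Matrix.of fun i j => A (σ⁻¹ i) (σ⁻¹ j)

/-- The standard scalar product `⟨A, B⟩ = ∑ i j, a_ij b_ij` on matrices. -/
def matInner {n : ℕ} (A B : Matrix (Fin n) (Fin n) ℝ) : ℝ :=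
  ∑ i, ∑ j, A i j * B i j

/-- The objective function `f(σ) = ⟨B, σ(A)⟩` of the Quadratic Assignment Problem. -/
def objective {n : ℕ} (A B : Matrix (Fin n) (Fin n) ℝ) (σ : Equiv.Perm (Fin n)) : ℝ :=
  matInner B (permMat σ A)

/-- The objective function `f(σ) = ∑ i j, c^{ij}_{σ(i) σ(j)}` of the generalized problem;
`C i j k l` stands for `c^{ij}_{kl}`. -/
def genObjective {n : ℕ} (C : Fin n → Fin n → Fin n → Fin n → ℝ)
    (σ : Equiv.Perm (Fin n)) : ℝ :=
  ∑ i, ∑ j, C i j (σ i) (σ j)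

/-- The average value of `f` on `S_n`. -/
def average {n : ℕ} (f : Equiv.Perm (Fin n) → ℝ) : ℝ :=
  1 / (n.factorial : ℝ) * ∑ σ, f σ

/-- The shifted function `f₀ = f - average f`. -/
def shifted {n : ℕ} (f : Equiv.Perm (Fin n) → ℝ) (σ : Equiv.Perm (Fin n)) : ℝ :=
  f σ - average f

/-- The probability that a uniformly random permutation in `S_n` lies in `S`. -/
def prob {n : ℕ} (S : Set (Equiv.Perm (Fin n))) : ℝ :=
  ((PMF.uniformOfFintype (Equiv.Perm (Fin n))).toOuterMeasure S).toReal

/-- `β(n, k) = (k - 2) / (n² - n k + k - 2)`. -/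
def beta (n k : ℕ) : ℝ :=
  ((k : ℝ) - 2) / ((n : ℝ) ^ 2 - (n : ℝ) * (k : ℝ) + (k : ℝ) - 2)

end QAP

end

/-! Replacing `f` by `f(τ ·)`, which is again a generalized objective, moves the maximum to the
identity. On a conjugation invariant set of permutations the coefficients may be averaged over
simultaneous relabelling. An invariant array depends only on coincidences among its four indices, so
the sum of `f₀` over the set equals the sum of `v(p, q) = a + b p + c p² + d q - m`, with `p` the
number of fixed points and `q` the number of points on cycles of length at most two
(`exists_class_coeffs`).

Under the uniform distribution `p`, `p²`, `q` have means 1, 2, 2, so `a + b + 2c + 2d = m`. The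
number `β` is chosen so that `β · identity + (1 - β) · uniform` has the same moments of `1, p, p²,
q` as a mixture of the classes `(p, q) = (k, k), (0, 0), (0, 2)`. Hence one of these classes has
average at least `β f₀(τ)` (`exists_class_average`).

Each class has at least `n!/(5 k!)` elements, because at least a fifth of the permutations of three
or more points have no cycle of length one or two. A reverse Markov inequality then turns a large
average into many large values. -/

namespace QAP

open Finset Equiv

/-! ### Counting permutations without short cycles -/

/-- A permutation all of whose cycles have length at least three. -/
def NoShortCycle {α : Type*} (σ : Perm α) : Prop := ∀ x, σ (σ x) ≠ x

open Classical in
/-- The number of permutations of an `m`-element set all of whose cycles have length at least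
three. -/
noncomputable def numNoShortCycle (m : ℕ) : ℕ := #{σ : Perm (Fin m) | NoShortCycle σ}

theorem card_noShortCycle (α : Type*) [Fintype α] [DecidableEq α]
    [DecidablePred (NoShortCycle (α := α))] :
    #{σ : Perm α | NoShortCycle σ} = numNoShortCycle (Fintype.card α) := by
  classical
  refine Finset.card_equiv (Fintype.equivFin α).permCongr fun σ => ?_
  rw [mem_filter_univ, mem_filter_univ]
  simp only [NoShortCycle, Equiv.permCongr_apply, Equiv.symm_apply_apply]
  constructor
  · intro h x hx
    exact h _ ((Fintype.equivFin α).eq_symm_apply.2 (by simpa using hx))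
  · intro h x hx
    exact h (Fintype.equivFin α x) (by simp [hx])

open Classical in
/-- The permutations which agree with `ρ` on `S` and have no short cycles outside `S`. -/
noncomputable def extensions {α : Type*} [Fintype α] (S : Finset α) (ρ : Perm α) :
    Finset (Perm α) :=
  {π | (∀ x ∈ S, π x = ρ x) ∧ ∀ x ∉ S, π (π x) ≠ x}

theorem mem_extensions {α : Type*} [Fintype α] {S : Finset α} {ρ π : Perm α} :
    π ∈ extensions S ρ ↔ (∀ x ∈ S, π x = ρ x) ∧ ∀ x ∉ S, π (π x) ≠ x := by
  classical
  simp [extensions]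

/-- Since `ρ` fixes every point off `S`, composing it with a permutation of the complement without
short cycles gives an extension, and distinct choices give distinct extensions. -/
theorem le_card_extensions {α : Type*} [Fintype α] (S : Finset α) (ρ : Perm α)
    (hρ : ∀ x ∉ S, ρ x = x) :
    numNoShortCycle (Fintype.card α - #S) ≤ #(extensions S ρ) := by
  classical
  have hc : Fintype.card α - #S = Fintype.card {x // x ∉ S} := by
    rw [Fintype.card_subtype_compl]; simp
  rw [hc, ← card_noShortCycle]
  have hS : ∀ x, ∀ hx : x ∉ S, ∀ σ : Perm {x // x ∉ S}, ∃ h : Perm.ofSubtype σ x ∉ S,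
      (⟨Perm.ofSubtype σ x, h⟩ : {x // x ∉ S}) = σ ⟨x, hx⟩ := by
    intro x hx σ
    rw [Perm.ofSubtype_apply_of_mem σ hx]
    exact ⟨(σ ⟨x, hx⟩).2, rfl⟩
  refine Finset.card_le_card_of_injOn (fun σ => ρ * Perm.ofSubtype σ) ?_ ?_
  · intro σ hσ
    rw [mem_coe, mem_filter_univ] at hσ
    simp only [mem_coe, mem_extensions, Perm.mul_apply]
    constructor
    · intro x hx
      rw [Perm.ofSubtype_apply_of_not_mem σ (by simpa using hx)]
    · intro x hx h
      obtain ⟨h1, h2⟩ := hS x hx σ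
      rw [hρ _ h1] at h
      obtain ⟨h3, h4⟩ := hS _ h1 σ
      rw [hρ _ h3] at h
      apply hσ ⟨x, hx⟩
      rw [← h2, ← h4]
      exact Subtype.ext h
  · intro σ _ σ' _ h
    exact Perm.ofSubtype_injective (mul_left_cancel h)

/-- Classify by the cycle through a distinguished point `none`. If its length is at least four,
deleting `none` leaves a permutation without short cycles; if it is three, the other two points of
the cycle and a permutation of the rest are free. -/
theorem numNoShortCycle_recurrence (m : ℕ) :
    (m + 2) * numNoShortCycle (m + 2) + (m + 2) * (m + 1) * numNoShortCycle m ≤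
      numNoShortCycle (m + 3) := by
  classical
  set β := Fin (m + 2)
  have hα : Fintype.card (Option β) = m + 3 := by simp [β]
  rw [← hα, ← card_noShortCycle]
  -- `e (a, σ)` inserts `none` immediately before `a` in its cycle of `σ`.
  let e : β × Perm β → Perm (Option β) := fun p => Perm.decomposeOption.symm (some p.1, p.2)
  let G₁ : Finset (Perm (Option β)) :=
    ((univ : Finset β) ×ˢ ({σ : Perm β | NoShortCycle σ} : Finset _)).image e
  let S : β × β → Finset (Option β) := fun p => {none, some p.1, some p.2}
  let ρ : β × β → Perm (Option β) := fun p =>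
    swap none (some p.1) * swap (some p.1) (some p.2)
  let G₂ : Finset (Perm (Option β)) :=
    (univ : Finset β).offDiag.biUnion fun p => extensions (S p) (ρ p)
  have hρ0 : ∀ p ∈ (univ : Finset β).offDiag, ρ p none = some p.1 := by
    intro p hp
    simp [ρ, swap_apply_of_ne_of_ne]
  have hρ1 : ∀ p ∈ (univ : Finset β).offDiag, ρ p (some p.1) = some p.2 := by
    intro p hp
    have : p.1 ≠ p.2 := by simpa using hp
    simp [ρ, swap_apply_of_ne_of_ne, this.symm]
  have hρ2 : ∀ p ∈ (univ : Finset β).offDiag, ρ p (some p.2) = none := by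
    intro p hp
    simp [ρ]
  have h2 : ∀ p ∈ (univ : Finset β).offDiag, ∀ π ∈ extensions (S p) (ρ p),
      π none = some p.1 ∧ π (some p.1) = some p.2 ∧ π (some p.2) = none := by
    intro p hp π hπ
    rw [mem_extensions] at hπ
    refine ⟨?_, ?_, ?_⟩
    · rw [hπ.1 _ (by simp [S]), hρ0 p hp]
    · rw [hπ.1 _ (by simp [S]), hρ1 p hp]
    · rw [hπ.1 _ (by simp [S]), hρ2 p hp]
  have hc1 : #G₁ = (m + 2) * numNoShortCycle (m + 2) := by
    rw [Finset.card_image_of_injective, card_product, card_noShortCycle]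
    · simp [β]
    · intro p q h
      have := Perm.decomposeOption.symm.injective h
      simp only [Prod.mk.injEq, Option.some.injEq] at this
      exact Prod.ext this.1 this.2
  have hc2 : (m + 2) * (m + 1) * numNoShortCycle m ≤ #G₂ := by
    rw [Finset.card_biUnion]
    · have : #((univ : Finset β).offDiag) = (m + 2) * (m + 1) := by
        rw [offDiag_card]; simp [β, ← Nat.mul_sub_one]
      rw [← this, ← smul_eq_mul]
      refine Finset.card_nsmul_le_sum _ _ _ fun p hp => ?_
      have hne : p.1 ≠ p.2 := by simpa using hp
      have hS : Fintype.card (Option β) - #(S p) = m := by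
        have : #(S p) = 3 := by
          simp [S, card_insert_of_notMem, hne]
        rw [hα, this]; rfl
      refine (congrArg numNoShortCycle hS).symm.trans_le
        (le_card_extensions _ _ fun x hx => ?_)
      simp only [S, mem_insert, mem_singleton, not_or] at hx
      simp only [ρ, Perm.mul_apply]
      rw [swap_apply_of_ne_of_ne hx.2.1 hx.2.2, swap_apply_of_ne_of_ne hx.1 hx.2.1]
    · intro p hp q hq hpq
      refine Finset.disjoint_left.2 fun π hπ hπ' => ?_
      obtain ⟨a1, a2, -⟩ := h2 p hp π hπ
      obtain ⟨b1, b2, -⟩ := h2 q hq π hπ'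
      have h1 : p.1 = q.1 := Option.some_injective _ (a1.symm.trans b1)
      rw [← h1] at b2
      exact hpq (Prod.ext h1 (Option.some_injective _ (a2.symm.trans b2)))
  have he : ∀ (a : β) (σ : Perm β),
      e (a, σ) none = some a ∧ (∀ x, σ x ≠ a → e (a, σ) (some x) = some (σ x)) ∧
        ∀ x, σ x = a → e (a, σ) (some x) = none := by
    intro a σ
    refine ⟨by simp [e], ?_, ?_⟩
    · intro x hx
      simp [e, swap_apply_of_ne_of_ne, hx]
    · intro x hx
      simp [e, hx]
  have hdisj : Disjoint G₁ G₂ := by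
    rw [Finset.disjoint_left]
    intro π h1 h2'
    simp only [G₁, mem_image, mem_product, mem_univ, true_and, mem_filter, Prod.exists] at h1
    obtain ⟨a, σ, hσ, rfl⟩ := h1
    simp only [G₂, mem_biUnion] at h2'
    obtain ⟨p, hp, hπ⟩ := h2'
    obtain ⟨a1, a2, a3⟩ := h2 p hp _ hπ
    obtain ⟨b1, b2, b3⟩ := he a σ
    have hpa : a = p.1 := Option.some_injective _ (b1.symm.trans a1)
    subst hpa
    have hne : σ p.1 ≠ p.1 := fun h => hσ p.1 (by rw [h, h])
    rw [b2 _ hne] at a2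
    have : σ p.1 = p.2 := Option.some_injective _ a2
    -- After an insertion, `none` does not return to itself in three steps, since `σ` has no
    -- 2-cycle.
    rw [← this, b2 _ (hσ p.1)] at a3
    simp at a3
  rw [← hc1]
  refine (Nat.add_le_add_left hc2 _).trans ?_
  rw [← card_union_of_disjoint hdisj]
  refine card_le_card ?_
  intro π hπ
  simp only [mem_filter, mem_univ, true_and]
  rcases mem_union.1 hπ with h | h
  · simp only [G₁, mem_image, mem_product, mem_univ, true_and, mem_filter, Prod.exists] at h
    obtain ⟨a, σ, hσ, rfl⟩ := h
    obtain ⟨b1, b2, b3⟩ := he a σ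
    have hne : ∀ x, σ x ≠ x := fun x h => hσ x (by rw [h, h])
    rintro (_ | x) hx
    · rw [b1, b2 _ (hne a)] at hx
      simp at hx
    · by_cases hxa : σ x = a
      · rw [b3 _ hxa, b1, ← hxa] at hx
        exact hne x (Option.some_injective _ hx)
      · rw [b2 _ hxa] at hx
        by_cases hxb : σ (σ x) = a
        · rw [b3 _ hxb] at hx
          simp at hx
        · rw [b2 _ hxb] at hx
          exact hσ x (Option.some_injective _ hx)
  · simp only [G₂, mem_biUnion] at h
    obtain ⟨p, hp, hπ⟩ := h
    obtain ⟨a1, a2, a3⟩ := h2 p hp _ hπ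
    have hpp : p.1 ≠ p.2 := by simpa using hp
    rw [mem_extensions] at hπ
    intro x hx
    by_cases hxS : x ∈ S p
    · simp only [S, mem_insert, mem_singleton] at hxS
      rcases hxS with rfl | rfl | rfl
      · rw [a1, a2] at hx; simp at hx
      · rw [a2, a3] at hx; simp at hx
      · rw [a3, a1] at hx; exact hpp (Option.some_injective _ hx)
    · exact hπ.2 x hxS hx

theorem numNoShortCycle_zero : numNoShortCycle 0 = 1 := by
  classical
  rw [numNoShortCycle, filter_true_of_mem]
  · simp
  · exact fun σ _ x => x.elim0

/-- Factorials satisfy the same recurrence with equality, so the ratio bound propagates from sizes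
3, 4, 5. The constant 5 comes from size 5, where the base bound reads `120 ≤ 5 * 24`. -/
theorem factorial_le_numNoShortCycle (m : ℕ) :
    (m + 3).factorial ≤ 5 * numNoShortCycle (m + 3) := by
  have h3 : 2 ≤ numNoShortCycle 3 := by
    have := numNoShortCycle_recurrence 0
    simp only [numNoShortCycle_zero, Nat.zero_add] at this
    omega
  have h4 : 6 ≤ numNoShortCycle 4 := by
    have := numNoShortCycle_recurrence 1
    norm_num at this
    omega
  have h5 : 24 ≤ numNoShortCycle 5 := by
    have := numNoShortCycle_recurrence 2
    norm_num at this
    omega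
  induction m using Nat.strong_induction_on with
  | _ m ih =>
    match m with
    | 0 => simp [Nat.factorial]; omega
    | 1 => simp [Nat.factorial]; omega
    | 2 => simp [Nat.factorial]; omega
    | m + 3 =>
      have e1 := ih (m + 2) (by omega)
      have e2 := ih m (by omega)
      have h := numNoShortCycle_recurrence (m + 3)
      have f1 : (m + 2 + 3).factorial = (m + 5) * ((m + 4) * (m + 3).factorial) := by
        simp [Nat.factorial_succ]
      have f2 : (m + 3 + 3).factorial = (m + 6) * ((m + 5) * ((m + 4) * (m + 3).factorial)) := by
        simp [Nat.factorial_succ]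
      rw [f1] at e1
      rw [f2]
      have g1 := Nat.mul_le_mul_left (m + 5) e1
      have g2 := Nat.mul_le_mul_left ((m + 5) * (m + 4)) e2
      calc _ = (m + 5) * ((m + 5) * ((m + 4) * (m + 3).factorial)) +
            (m + 5) * (m + 4) * (m + 3).factorial := by ring
        _ ≤ _ := Nat.add_le_add g1 g2
        _ = 5 * ((m + 3 + 2) * numNoShortCycle (m + 3 + 2) +
            (m + 3 + 2) * (m + 3 + 1) * numNoShortCycle (m + 3)) := by ring
        _ ≤ _ := Nat.mul_le_mul_left 5 h

/-! ### Sizes of the three classes -/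

/-- The number of fixed points of a permutation. -/
def fixCount {n : ℕ} (σ : Perm (Fin n)) : ℕ := #{i | σ i = i}

/-- The number of points which lie on cycles of length at most two. -/
def invCount {n : ℕ} (σ : Perm (Fin n)) : ℕ := #{i | σ (σ i) = i}

/-- The permutations with `a` fixed points and `b` points on cycles of length at most two. -/
def countClass (n a b : ℕ) : Finset (Perm (Fin n)) := {σ | fixCount σ = a ∧ invCount σ = b}

theorem mem_countClass {n a b : ℕ} {σ : Perm (Fin n)} :
    σ ∈ countClass n a b ↔ fixCount σ = a ∧ invCount σ = b := by
  simp [countClass]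

/-- Choose the set `S` of points on short cycles, let `ρ S` act there as an involution, and complete
without short cycles. `S` can be read off from the result, so nothing is counted twice. -/
theorem le_card_countClass {n : ℕ} (a b : ℕ) (ρ : Finset (Fin n) → Perm (Fin n))
    (hout : ∀ S, #S = b → ∀ x ∉ S, ρ S x = x)
    (hin : ∀ S, #S = b → ∀ x ∈ S, ρ S x ∈ S ∧ ρ S (ρ S x) = x)
    (hfix : ∀ S, #S = b → #{x ∈ S | ρ S x = x} = a) :
    n.choose b * numNoShortCycle (n - b) ≤ #(countClass n a b) := by
  classical
  have key : ∀ S, #S = b → ∀ π ∈ extensions S (ρ S), ({i | π (π i) = i} : Finset _) = S := by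
    intro S hS π hπ
    rw [mem_extensions] at hπ
    ext x
    simp only [mem_filter, mem_univ, true_and]
    constructor
    · intro h
      by_contra hx
      exact hπ.2 x hx h
    · intro hx
      rw [hπ.1 x hx, hπ.1 _ (hin S hS x hx).1, (hin S hS x hx).2]
  have hsub : ((univ : Finset (Fin n)).powersetCard b).biUnion (fun S => extensions S (ρ S)) ⊆
      countClass n a b := by
    intro π hπ
    simp only [mem_biUnion, mem_powersetCard, subset_univ, true_and] at hπ
    obtain ⟨S, hS, hπ⟩ := hπ
    have hk := key S hS π hπ
    rw [mem_countClass, invCount, hk, ← hfix S hS, fixCount]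
    refine ⟨?_, hS⟩
    congr 1
    rw [mem_extensions] at hπ
    ext x
    simp only [mem_filter, mem_univ, true_and]
    constructor
    · intro h
      have hx : x ∈ S := by
        by_contra hx
        exact hπ.2 x hx (by rw [h, h])
      exact ⟨hx, (hπ.1 x hx).symm.trans h⟩
    · rintro ⟨hx, h⟩
      rw [hπ.1 x hx, h]
  refine le_trans ?_ (card_le_card hsub)
  rw [card_biUnion]
  · have : n.choose b = #((univ : Finset (Fin n)).powersetCard b) := by simp
    rw [this, ← smul_eq_mul]
    refine Finset.card_nsmul_le_sum _ _ _ fun S hS => ?_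
    have hS : #S = b := (mem_powersetCard.1 hS).2
    have := le_card_extensions S (ρ S) (hout S hS)
    rwa [Fintype.card_fin, hS] at this
  · intro S hS T hT hST
    refine Finset.disjoint_left.2 fun π h1 h2 => ?_
    have hS : #S = b := (mem_powersetCard.1 hS).2
    have hT : #T = b := (mem_powersetCard.1 hT).2
    exact hST ((key S hS π h1).symm.trans (key T hT π h2))

theorem factorial_le_card_countClass_self {n k : ℕ} (h : k + 3 ≤ n) :
    n.factorial ≤ 5 * k.factorial * #(countClass n k k) := by
  have h1 := le_card_countClass (n := n) k k (fun _ => 1) (by simp)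
    (by simp +contextual) (by simp)
  obtain ⟨m, hm⟩ : ∃ m, n - k = m + 3 := ⟨n - k - 3, by omega⟩
  have h2 := factorial_le_numNoShortCycle m
  rw [← hm] at h2
  rw [← Nat.choose_mul_factorial_mul_factorial (show k ≤ n by omega)]
  calc _ ≤ n.choose k * k.factorial * (5 * numNoShortCycle (n - k)) := Nat.mul_le_mul_left _ h2
    _ = 5 * k.factorial * (n.choose k * numNoShortCycle (n - k)) := by ring
    _ ≤ _ := Nat.mul_le_mul_left _ h1

theorem factorial_le_card_countClass_two {n : ℕ} (h : 5 ≤ n) :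
    n.factorial ≤ 10 * #(countClass n 0 2) := by
  classical
  have hex : ∀ S : Finset (Fin n), ∃ ρ : Perm (Fin n), #S = 2 → (∀ x ∉ S, ρ x = x) ∧
      (∀ x ∈ S, ρ x ∈ S ∧ ρ (ρ x) = x) ∧ #{x ∈ S | ρ x = x} = 0 := by
    intro S
    by_cases hS : #S = 2
    · obtain ⟨a, b, hab, rfl⟩ := card_eq_two.1 hS
      refine ⟨swap a b, fun _ => ⟨?_, ?_, ?_⟩⟩
      · intro x hx
        simp only [mem_insert, mem_singleton, not_or] at hx
        exact swap_apply_of_ne_of_ne hx.1 hx.2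
      · intro x hx
        simp only [mem_insert, mem_singleton] at hx
        rcases hx with rfl | rfl <;> simp
      · rw [card_eq_zero, filter_eq_empty_iff]
        intro x hx
        simp only [mem_insert, mem_singleton] at hx
        rcases hx with rfl | rfl <;> simp [hab, hab.symm]
    · exact ⟨1, fun h => absurd h hS⟩
  choose ρ hρ using hex
  have h1 := le_card_countClass (n := n) 0 2 ρ (fun S hS => (hρ S hS).1)
    (fun S hS => (hρ S hS).2.1) (fun S hS => (hρ S hS).2.2)
  obtain ⟨m, hm⟩ : ∃ m, n - 2 = m + 3 := ⟨n - 2 - 3, by omega⟩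
  have h2 := factorial_le_numNoShortCycle m
  rw [← hm] at h2
  rw [← Nat.choose_mul_factorial_mul_factorial (show 2 ≤ n by omega)]
  calc _ ≤ n.choose 2 * Nat.factorial 2 * (5 * numNoShortCycle (n - 2)) :=
        Nat.mul_le_mul_left _ h2
    _ = 10 * (n.choose 2 * numNoShortCycle (n - 2)) := by
        rw [Nat.factorial_two]; ring
    _ ≤ _ := Nat.mul_le_mul_left _ h1

/-! ### Reduction to fixed points and short cycles -/

theorem exists_perm_apply_eq {n m : ℕ} (f g : Fin m → Fin n) (hf : Function.Injective f)
    (hg : Function.Injective g) : ∃ π : Perm (Fin n), ∀ i, π (f i) = g i := by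
  have h := Equiv.Perm.isMultiplyPretransitive (Fin n) m
  obtain ⟨π, hπ⟩ := h.exists_smul_eq ⟨f, hf⟩ ⟨g, hg⟩
  exact ⟨π, fun i => congrArg (fun F : Fin m ↪ Fin n => F i) hπ⟩

theorem injective_vec_two {α : Type*} {a b : α} (h : a ≠ b) : Function.Injective ![a, b] := by
  intro i j hij
  fin_cases i <;> fin_cases j <;> simp_all [eq_comm]

theorem injective_vec_three {α : Type*} {a b c : α} (h : a ≠ b) (h₁ : a ≠ c) (h₂ : b ≠ c) :
    Function.Injective ![a, b, c] := by
  intro i j hij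
  fin_cases i <;> fin_cases j <;> simp_all [eq_comm]

theorem injective_vec_four {α : Type*} {a b c d : α} (h : a ≠ b) (h₁ : a ≠ c) (h₂ : a ≠ d)
    (h₃ : b ≠ c) (h₄ : b ≠ d) (h₅ : c ≠ d) : Function.Injective ![a, b, c, d] := by
  intro i j hij
  fin_cases i <;> fin_cases j <;> simp_all [eq_comm]

/-- An invariant function of four points depends only on the coincidences between them. -/
theorem exists_pattern_coeffs {n : ℕ} (hn : 4 ≤ n) (H : Fin n → Fin n → Fin n → Fin n → ℝ)
    (hH : ∀ (π : Perm (Fin n)) i j u v, H (π i) (π j) (π u) (π v) = H i j u v) :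
    ∃ e₀ e₁ e₂ e₃ e₄ e₅ e₆ d₀ d₁ : ℝ, ∀ i j u v, (i = j ↔ u = v) →
      H i j u v = e₀ + e₁ * (if u = i then 1 else 0) + e₂ * (if v = j then 1 else 0)
        + e₃ * ((if u = i then 1 else 0) * (if v = j then 1 else 0))
        + e₄ * (if u = j then 1 else 0) + e₅ * (if v = i then 1 else 0)
        + e₆ * ((if u = j then 1 else 0) * (if v = i then 1 else 0))
        + (if i = j then d₀ + d₁ * (if u = i then 1 else 0) else 0) := by
  obtain ⟨a, b, c, d, hab, hac, had, hbc, hbd, hcd⟩ : ∃ a b c d : Fin n,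
      a ≠ b ∧ a ≠ c ∧ a ≠ d ∧ b ≠ c ∧ b ≠ d ∧ c ≠ d :=
    ⟨⟨0, by omega⟩, ⟨1, by omega⟩, ⟨2, by omega⟩, ⟨3, by omega⟩, by simp⟩
  have H1 : ∀ i, H i i i i = H a a a a := by
    intro i
    rw [← hH (swap i a) i i i i]
    simp
  have H2 : ∀ {i j}, i ≠ j → ∀ F : (Fin 2 → Fin n) → ℝ,
      (∀ (π : Perm (Fin n)) x, F (fun t => π (x t)) = F x) → F ![i, j] = F ![a, b] := by
    intro i j hij F hF
    obtain ⟨π, hπ⟩ := exists_perm_apply_eq _ _ (injective_vec_two hij) (injective_vec_two hab)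
    rw [← hF π ![i, j]]
    exact congrArg F (funext hπ)
  have H3 : ∀ {i j k}, i ≠ j → i ≠ k → j ≠ k → ∀ F : (Fin 3 → Fin n) → ℝ,
      (∀ (π : Perm (Fin n)) x, F (fun t => π (x t)) = F x) → F ![i, j, k] = F ![a, b, c] := by
    intro i j k h1 h2 h3 F hF
    obtain ⟨π, hπ⟩ := exists_perm_apply_eq _ _ (injective_vec_three h1 h2 h3)
      (injective_vec_three hab hac hbc)
    rw [← hF π ![i, j, k]]
    exact congrArg F (funext hπ)
  have H4 : ∀ {i j k l}, i ≠ j → i ≠ k → i ≠ l → j ≠ k → j ≠ l → k ≠ l →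
      H i j k l = H a b c d := by
    intro i j k l h1 h2 h3 h4 h5 h6
    obtain ⟨π, hπ⟩ := exists_perm_apply_eq _ _ (injective_vec_four h1 h2 h3 h4 h5 h6)
      (injective_vec_four hab hac had hbc hbd hcd)
    rw [← hH π i j k l]
    have e0 : π i = a := hπ 0
    have e1 : π j = b := hπ 1
    have e2 : π k = c := hπ 2
    have e3 : π l = d := hπ 3
    rw [e0, e1, e2, e3]
  have Hiiuu : ∀ {i u}, i ≠ u → H i i u u = H a a b b := fun h =>
    H2 h (fun x => H (x 0) (x 0) (x 1) (x 1)) fun π x => hH π _ _ _ _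
  have Hijij : ∀ {i j}, i ≠ j → H i j i j = H a b a b := fun h =>
    H2 h (fun x => H (x 0) (x 1) (x 0) (x 1)) fun π x => hH π _ _ _ _
  have Hijji : ∀ {i j}, i ≠ j → H i j j i = H a b b a := fun h =>
    H2 h (fun x => H (x 0) (x 1) (x 1) (x 0)) fun π x => hH π _ _ _ _
  have Hijik : ∀ {i j k}, i ≠ j → i ≠ k → j ≠ k → H i j i k = H a b a c := fun h h' h'' =>
    H3 h h' h'' (fun x => H (x 0) (x 1) (x 0) (x 2)) fun π x => hH π _ _ _ _
  have Hijkj : ∀ {i j k}, i ≠ j → i ≠ k → j ≠ k → H i j k j = H a b c b := fun h h' h'' =>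
    H3 h h' h'' (fun x => H (x 0) (x 1) (x 2) (x 1)) fun π x => hH π _ _ _ _
  have Hijjk : ∀ {i j k}, i ≠ j → i ≠ k → j ≠ k → H i j j k = H a b b c := fun h h' h'' =>
    H3 h h' h'' (fun x => H (x 0) (x 1) (x 1) (x 2)) fun π x => hH π _ _ _ _
  have Hijki : ∀ {i j k}, i ≠ j → i ≠ k → j ≠ k → H i j k i = H a b c a := fun h h' h'' =>
    H3 h h' h'' (fun x => H (x 0) (x 1) (x 2) (x 0)) fun π x => hH π _ _ _ _
  -- Inclusion–exclusion over the coincidence patterns off the diagonal; the last two coefficients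
  -- correct the diagonal.
  refine ⟨H a b c d, H a b a c - H a b c d, H a b c b - H a b c d,
    H a b a b - H a b a c - H a b c b + H a b c d, H a b b c - H a b c d, H a b c a - H a b c d,
    H a b b a - H a b b c - H a b c a + H a b c d, H a a b b - H a b c d,
    H a a a a - H a a b b - H a b a b - H a b b a + 2 * H a b c d, ?_⟩
  intro i j u v hijuv
  by_cases hij : i = j
  · have huv := hijuv.1 hij
    subst hij huv
    by_cases hui : u = i
    · subst hui
      rw [H1]; simp only [if_true]; ring
    · rw [Hiiuu (Ne.symm hui)]; simp only [hui, if_true, if_false]; ring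
  · have huv : u ≠ v := fun h => hij (hijuv.2 h)
    by_cases hui : u = i
    · subst hui
      by_cases hvj : v = j
      · subst hvj
        rw [Hijij hij]; simp only [huv, huv.symm, if_true, if_false]; ring
      · rw [Hijik hij huv (Ne.symm hvj)]
        simp only [hij, hvj, huv.symm, if_true, if_false]; ring
    · by_cases hvj : v = j
      · subst hvj
        rw [Hijkj hij (Ne.symm hui) huv.symm]
        simp only [hui, huv, hij, Ne.symm hij, if_true, if_false]; ring
      · by_cases huj : u = j
        · subst huj
          by_cases hvi : v = i
          · subst hvi
            rw [Hijji hij]; simp only [huv, huv.symm, if_true, if_false]; ring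
          · rw [Hijjk hij (Ne.symm hvi) huv]
            simp only [hui, hvj, hvi, hij, if_true, if_false]; ring
        · by_cases hvi : v = i
          · subst hvi
            rw [Hijki hij (Ne.symm hui) (Ne.symm huj)]
            simp only [hui, hvj, huj, if_true, if_false]; ring
          · rw [H4 hij (Ne.symm hui) (Ne.symm hvi) (Ne.symm huj) (Ne.symm hvj) huv]
            simp only [hui, hvj, huj, hvi, hij, if_false]; ring

theorem fixCount_eq_sum {n : ℕ} (σ : Perm (Fin n)) :
    (fixCount σ : ℝ) = ∑ i, if σ i = i then 1 else 0 := by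
  simp [fixCount]

theorem fixCount_sq_eq_sum {n : ℕ} (σ : Perm (Fin n)) :
    (fixCount σ : ℝ) ^ 2 =
      ∑ i, ∑ j, (if σ i = i then 1 else 0) * (if σ j = j then 1 else 0) := by
  rw [sq, fixCount_eq_sum, Finset.sum_mul_sum]

theorem invCount_eq_sum {n : ℕ} (σ : Perm (Fin n)) :
    (invCount σ : ℝ) = ∑ i, ∑ j, (if σ i = j then 1 else 0) * (if σ j = i then 1 else 0) := by
  simp only [invCount, ite_mul, one_mul, zero_mul, Finset.sum_ite_eq, mem_univ, if_true]
  simp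

/-- On conjugation invariant sets of permutations, a quadratic assignment objective has the same
sums as a fixed combination of `1`, `p`, `p ^ 2` and `q`, where `p` counts the fixed points and `q`
counts the points on cycles of length at most two. -/
theorem exists_class_coeffs {n : ℕ} (hn : 4 ≤ n) (C : Fin n → Fin n → Fin n → Fin n → ℝ) :
    ∃ a b c d : ℝ, ∀ X : Finset (Perm (Fin n)), (∀ π σ, σ ∈ X → π * σ * π⁻¹ ∈ X) →
      ∑ σ ∈ X, genObjective C σ =
        ∑ σ ∈ X, (a + b * fixCount σ + c * (fixCount σ : ℝ) ^ 2 + d * invCount σ) := by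
  set H : Fin n → Fin n → Fin n → Fin n → ℝ := fun i j u v =>
    ∑ π : Perm (Fin n), C (π i) (π j) (π u) (π v)
  obtain ⟨e₀, e₁, e₂, e₃, e₄, e₅, e₆, d₀, d₁, hE⟩ := exists_pattern_coeffs hn H (by
    intro π i j u v
    exact Equiv.sum_comp (Equiv.mulRight π) (fun ρ : Perm (Fin n) => C (ρ i) (ρ j) (ρ u) (ρ v)))
  have hclass : ∀ σ : Perm (Fin n), ∑ i, ∑ j, H i j (σ i) (σ j) =
      (e₀ * n ^ 2 + (e₄ + e₅) * n + d₀ * n) + ((e₁ + e₂) * n + d₁) * fixCount σ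
        + e₃ * (fixCount σ : ℝ) ^ 2 + e₆ * invCount σ := by
    intro σ
    have h1 : ∀ i j, H i j (σ i) (σ j) = _ := fun i j => hE i j (σ i) (σ j) (by simp)
    have hsq := fixCount_sq_eq_sum σ
    simp only [← Finset.mul_sum, ← fixCount_eq_sum] at hsq
    simp only [h1, Finset.sum_add_distrib, ← Finset.mul_sum, ← invCount_eq_sum,
      ← fixCount_eq_sum, ← hsq]
    have h2 : ∑ i, ∑ j, (if i = j then d₀ + d₁ * (if σ i = i then (1 : ℝ) else 0) else 0) =
        d₀ * n + d₁ * fixCount σ := by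
      simp only [Finset.sum_ite_eq, mem_univ, if_true, Finset.sum_add_distrib, ← Finset.mul_sum,
        ← fixCount_eq_sum]
      simp [mul_comm]
    have h3 : ∑ i, ∑ j, (if σ j = i then (1 : ℝ) else 0) = n := by
      rw [Finset.sum_comm]; simp
    have h4 : ∑ i, ∑ j, (if σ i = j then (1 : ℝ) else 0) = n := by simp
    have h5 : ∑ i, ∑ _j : Fin n, (if σ i = i then (1 : ℝ) else 0) = n * fixCount σ := by
      simp only [Finset.sum_const, card_univ, Fintype.card_fin, nsmul_eq_mul, ← Finset.mul_sum,
        ← fixCount_eq_sum]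
    have h6 : ∑ _i : Fin n, (fixCount σ : ℝ) = n * fixCount σ := by simp
    simp only [h2, h3, h4, h5, h6]
    simp only [Finset.sum_const, card_univ, Fintype.card_fin, nsmul_eq_mul]
    ring
  have hfac : (n.factorial : ℝ) ≠ 0 := by positivity
  refine ⟨(e₀ * n ^ 2 + (e₄ + e₅) * n + d₀ * n) / n.factorial,
    ((e₁ + e₂) * n + d₁) / n.factorial, e₃ / n.factorial, e₆ / n.factorial, fun X hX => ?_⟩
  -- Relabelling the indices by `π` amounts to conjugating `σ`, which permutes `X`.
  have hconj : ∀ π : Perm (Fin n), ∑ σ ∈ X, ∑ i, ∑ j, C (π i) (π j) (π (σ i)) (π (σ j)) =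
      ∑ σ ∈ X, genObjective C σ := by
    intro π
    refine Finset.sum_bij' (fun σ _ => π * σ * π⁻¹) (fun σ _ => π⁻¹ * σ * π)
      (fun σ h => hX π σ h) (fun σ h => by simpa using hX π⁻¹ σ h) (fun σ _ => by group)
      (fun σ _ => by group) fun σ _ => ?_
    rw [genObjective, ← Equiv.sum_comp π
      (fun i => ∑ j, C i j ((π * σ * π⁻¹) i) ((π * σ * π⁻¹) j))]
    refine Finset.sum_congr rfl fun i _ => ?_
    rw [← Equiv.sum_comp π (fun j => C (π i) j _ ((π * σ * π⁻¹) j))]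
    simp
  have hsum : (n.factorial : ℝ) * ∑ σ ∈ X, genObjective C σ =
      ∑ σ ∈ X, ∑ i, ∑ j, H i j (σ i) (σ j) := by
    calc (n.factorial : ℝ) * ∑ σ ∈ X, genObjective C σ
        = ∑ π : Perm (Fin n), ∑ σ ∈ X, ∑ i, ∑ j, C (π i) (π j) (π (σ i)) (π (σ j)) := by
          simp [hconj, Fintype.card_perm]
      _ = _ := by
          rw [Finset.sum_comm]
          refine Finset.sum_congr rfl fun σ _ => ?_
          rw [Finset.sum_comm]
          refine Finset.sum_congr rfl fun i _ => ?_
          rw [Finset.sum_comm]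
  rw [← mul_right_inj' hfac, hsum, Finset.mul_sum]
  refine Finset.sum_congr rfl fun σ _ => ?_
  rw [hclass σ]
  field_simp

/-! ### Moments under the uniform distribution -/

theorem sum_indicator_one {n : ℕ} (i u : Fin n) :
    (n : ℝ) * ∑ σ : Perm (Fin n), (if σ i = u then (1 : ℝ) else 0) = n.factorial := by
  have h : ∀ v, ∑ σ : Perm (Fin n), (if σ i = v then (1 : ℝ) else 0) =
      ∑ σ : Perm (Fin n), (if σ i = u then (1 : ℝ) else 0) := by
    intro v
    rw [← Equiv.sum_comp (Equiv.mulLeft (swap u v))]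
    refine Finset.sum_congr rfl fun σ _ => ?_
    simp [Equiv.swap_apply_eq_iff]
  calc (n : ℝ) * ∑ σ : Perm (Fin n), (if σ i = u then (1 : ℝ) else 0)
      = ∑ v, ∑ σ : Perm (Fin n), (if σ i = v then (1 : ℝ) else 0) := by simp [h]
    _ = n.factorial := by rw [Finset.sum_comm]; simp [Fintype.card_perm]

theorem sum_indicator_two {n : ℕ} {i j u v : Fin n} (hij : i ≠ j) (huv : u ≠ v) :
    ((n : ℝ) * (n - 1)) * ∑ σ : Perm (Fin n),
      (if σ i = u then (1 : ℝ) else 0) * (if σ j = v then 1 else 0) = n.factorial := by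
  have h : ∀ x ∈ (univ : Finset (Fin n)).offDiag, ∑ σ : Perm (Fin n),
      (if σ i = x.1 then (1 : ℝ) else 0) * (if σ j = x.2 then 1 else 0) =
      ∑ σ : Perm (Fin n), (if σ i = u then (1 : ℝ) else 0) * (if σ j = v then 1 else 0) := by
    intro x hx
    have hx' : x.1 ≠ x.2 := by simpa using hx
    obtain ⟨π, hπ⟩ := exists_perm_apply_eq _ _ (injective_vec_two huv) (injective_vec_two hx')
    have h0 : π u = x.1 := hπ 0
    have h1 : π v = x.2 := hπ 1
    rw [← Equiv.sum_comp (Equiv.mulLeft π)]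
    refine Finset.sum_congr rfl fun σ _ => ?_
    simp [← h0, ← h1]
  have hc : ((#((univ : Finset (Fin n)).offDiag) : ℕ) : ℝ) = (n : ℝ) * (n - 1) := by
    rw [offDiag_card, card_univ, Fintype.card_fin, Nat.cast_sub (Nat.le_mul_self n)]
    push_cast; ring
  rw [← hc, ← nsmul_eq_mul, ← Finset.sum_const, ← Finset.sum_congr rfl h, Finset.sum_comm]
  have h1 : ∀ σ : Perm (Fin n), ∑ x ∈ (univ : Finset (Fin n)).offDiag,
      (if σ i = x.1 then (1 : ℝ) else 0) * (if σ j = x.2 then 1 else 0) = 1 := by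
    intro σ
    rw [Finset.sum_eq_single (σ i, σ j)]
    · simp
    · intro x _ hx
      by_cases h1 : σ i = x.1
      · by_cases h2 : σ j = x.2
        · exact absurd (Prod.ext h1.symm h2.symm) hx
        · simp [h2]
      · simp [h1]
    · intro hx
      simp [hij] at hx
  rw [Finset.sum_congr rfl fun σ _ => h1 σ]
  simp [Fintype.card_perm]

theorem sum_fixCount {n : ℕ} (hn : 1 ≤ n) :
    ∑ σ : Perm (Fin n), (fixCount σ : ℝ) = n.factorial := by
  have hn' : (n : ℝ) ≠ 0 := by positivity
  simp only [fixCount_eq_sum]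
  rw [Finset.sum_comm, ← mul_right_inj' hn', Finset.mul_sum]
  simp only [sum_indicator_one]
  simp

/-- A double sum over pairs of points, where the diagonal and off-diagonal terms have total mass
`N` each. -/
theorem sum_sum_of_diag {n : ℕ} (hn : 2 ≤ n) (N : ℝ) (g : Fin n → Fin n → ℝ)
    (hd : ∀ i, n * g i i = N) (ho : ∀ i j, i ≠ j → (n * (n - 1)) * g i j = N) :
    ∑ i, ∑ j, g i j = 2 * N := by
  have h2 : (2 : ℝ) ≤ n := by exact_mod_cast hn
  have hn0 : (n : ℝ) ≠ 0 := by positivity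
  have hn1 : (n : ℝ) - 1 ≠ 0 := by linarith
  have hg : ∀ i j, g i j = N / (n * (n - 1)) + if i = j then N / n - N / (n * (n - 1)) else 0 := by
    intro i j
    by_cases h : i = j
    · subst h
      rw [← hd i]; simp only [if_true]; field_simp; ring
    · rw [← ho i j h]; simp only [h, if_false]; field_simp; ring
  simp only [hg, Finset.sum_add_distrib, Finset.sum_ite_eq, mem_univ, if_true, Finset.sum_const,
    card_univ, Fintype.card_fin, nsmul_eq_mul]
  field_simp
  ring

theorem sum_fixCount_sq {n : ℕ} (hn : 2 ≤ n) :
    ∑ σ : Perm (Fin n), (fixCount σ : ℝ) ^ 2 = 2 * n.factorial := by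
  simp only [fixCount_sq_eq_sum]
  rw [Finset.sum_comm]
  simp_rw [Finset.sum_comm (s := (univ : Finset (Perm (Fin n))))]
  refine sum_sum_of_diag hn _ _ (fun i => ?_) fun i j hij => sum_indicator_two hij hij
  rw [← sum_indicator_one i i]
  simp only [← ite_and, mul_ite, mul_one, mul_zero, and_self]

theorem sum_invCount {n : ℕ} (hn : 2 ≤ n) :
    ∑ σ : Perm (Fin n), (invCount σ : ℝ) = 2 * n.factorial := by
  simp only [invCount_eq_sum]
  rw [Finset.sum_comm]
  simp_rw [Finset.sum_comm (s := (univ : Finset (Perm (Fin n))))]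
  refine sum_sum_of_diag hn _ _ (fun i => ?_) fun i j hij => sum_indicator_two hij hij.symm
  rw [← sum_indicator_one i i]
  simp only [← ite_and, mul_ite, mul_one, mul_zero, and_self]

/-! ### Conjugacy, probability and averaging tools -/

theorem conj_mem_countClass {n a b : ℕ} (π σ : Perm (Fin n)) (h : σ ∈ countClass n a b) :
    π * σ * π⁻¹ ∈ countClass n a b := by
  rw [mem_countClass] at h ⊢
  rw [← h.1, ← h.2]
  constructor
  · refine (Finset.card_equiv π fun i => ?_).symm
    rw [mem_filter_univ, mem_filter_univ]
    simp
  · refine (Finset.card_equiv π fun i => ?_).symm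
    rw [mem_filter_univ, mem_filter_univ]
    simp

theorem objective_eq_genObjective {n : ℕ} (A B : Matrix (Fin n) (Fin n) ℝ) :
    objective A B = genObjective fun i j u v => B u v * A i j := by
  funext σ
  rw [objective, matInner, genObjective, ← Equiv.sum_comp σ]
  refine Finset.sum_congr rfl fun i _ => ?_
  rw [← Equiv.sum_comp σ (fun j => B (σ i) j * permMat σ A (σ i) j)]
  simp [permMat]

theorem sum_shifted {n : ℕ} (f : Perm (Fin n) → ℝ) : ∑ σ, shifted f σ = 0 := by
  have : (n.factorial : ℝ) ≠ 0 := by positivity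
  simp only [shifted, average, Finset.sum_sub_distrib, Finset.sum_const, card_univ,
    Fintype.card_perm, Fintype.card_fin, nsmul_eq_mul]
  field_simp
  ring

open Classical in
theorem prob_eq {n : ℕ} (p : Perm (Fin n) → Prop) :
    prob {σ | p σ} = (#{σ | p σ} : ℝ) / n.factorial := by
  rw [prob, PMF.toOuterMeasure_uniformOfFintype_apply, Fintype.card_perm, Fintype.card_fin,
    ENNReal.toReal_div, ENNReal.toReal_natCast, ENNReal.toReal_natCast]
  congr 2
  exact Fintype.card_subtype p

open Classical in
/-- A bounded function with a large average takes large values often. -/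
theorem mul_card_le_card_filter {ι : Type*} [Fintype ι] (X : Finset ι) (F : ι → ℝ) {M b γ : ℝ}
    (hM : 0 ≤ M) (hF : ∀ x, F x ≤ M) (hb0 : 0 ≤ b) (hb1 : b ≤ 1) (hγ0 : 0 ≤ γ)
    (havg : b * M * #X ≤ ∑ x ∈ X, F x) :
    (1 - γ) * b * #X ≤ #{x | γ * b * M ≤ F x} := by
  have hsub : #{x ∈ X | γ * b * M ≤ F x} ≤ #{x | γ * b * M ≤ F x} :=
    card_le_card (filter_subset_filter _ (subset_univ X))
  have hsub' : (#{x ∈ X | γ * b * M ≤ F x} : ℝ) ≤ #{x | γ * b * M ≤ F x} := by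
    exact_mod_cast hsub
  refine le_trans ?_ hsub'
  have hX : (0 : ℝ) ≤ #X := by positivity
  rcases hM.eq_or_lt with rfl | hM
  -- When `M = 0` one cannot cancel `M`; instead nonpositive values with nonnegative sum must all
  -- vanish.
  · have hall : {x ∈ X | γ * b * 0 ≤ F x} = X := by
      refine filter_true_of_mem fun x hx => ?_
      have h := Finset.sum_eq_zero_iff_of_nonpos (s := X) (fun x _ => hF x)
      rw [mul_zero, h.1 (le_antisymm (Finset.sum_nonpos fun x _ => hF x) (by simpa using havg)) x hx]
    rw [hall]
    have : (1 - γ) * b ≤ 1 := by nlinarith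
    nlinarith
  · have hbound : ∑ x ∈ X, F x ≤
        ∑ x ∈ X, (γ * b * M + if γ * b * M ≤ F x then M else 0) := by
      refine Finset.sum_le_sum fun x _ => ?_
      have h0 : 0 ≤ γ * b * M := by positivity
      split_ifs with h
      · linarith [hF x]
      · linarith
    rw [Finset.sum_add_distrib, Finset.sum_const, nsmul_eq_mul, ← Finset.sum_filter,
      Finset.sum_const, nsmul_eq_mul] at hbound
    have : ((1 - γ) * b * #X) * M ≤ #{x ∈ X | γ * b * M ≤ F x} * M := by linarith
    exact le_of_mul_le_mul_right this hM

/-- The third claim makes the weight of the class `(0, 0)` nonnegative: by the fourth, the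
difference of its two sides is `β (n - k) (n - 2)`. The fourth matches the second moments of `p`. -/
theorem beta_spec {n k : ℕ} (hk : 3 ≤ k) (hkn : k + 5 ≤ n) :
    0 < beta n k ∧ beta n k < 1 ∧ 2 * (1 + beta n k * (n - 1)) ≤ k * (1 + beta n k) ∧
      beta n k * ((n : ℝ) ^ 2 - n * k + k - 2) = k - 2 := by
  have h3 : (3 : ℝ) ≤ k := by exact_mod_cast hk
  have h5 : (k : ℝ) + 5 ≤ n := by exact_mod_cast hkn
  have hD : (k : ℝ) - 2 < (n : ℝ) ^ 2 - n * k + k - 2 := by nlinarith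
  have hD0 : (0 : ℝ) < (n : ℝ) ^ 2 - n * k + k - 2 := by linarith
  have hβ : beta n k * ((n : ℝ) ^ 2 - n * k + k - 2) = k - 2 := by
    rw [beta, div_mul_cancel₀ _ hD0.ne']
  have hpos : 0 < beta n k := div_pos (by linarith) hD0
  refine ⟨hpos, (div_lt_one hD0).2 hD, ?_, hβ⟩
  have h1 : 0 ≤ beta n k * (((n : ℝ) - k) * (n - 2)) :=
    mul_nonneg hpos.le (mul_nonneg (by linarith) (by linarith))
  linarith

theorem sum_countClass {n a b : ℕ} (g : ℝ → ℝ → ℝ) :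
    ∑ σ ∈ countClass n a b, g (fixCount σ) (invCount σ) = #(countClass n a b) * g a b := by
  rw [← nsmul_eq_mul, ← Finset.sum_const]
  refine Finset.sum_congr rfl fun σ hσ => ?_
  rw [mem_countClass] at hσ
  rw [hσ.1, hσ.2]

/-! ### The averaging argument -/

/-- One of three large classes of permutations has average at least `β(n, k)` times the value at
the identity. -/
theorem exists_class_average {n k : ℕ} (hk : 3 ≤ k) (hkn : k + 5 ≤ n)
    (C : Fin n → Fin n → Fin n → Fin n → ℝ) (m : ℝ)
    (hm : ∑ σ : Perm (Fin n), (genObjective C σ - m) = 0) :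
    ∃ X : Finset (Perm (Fin n)), n.factorial ≤ 5 * k.factorial * #X ∧
      beta n k * (genObjective C 1 - m) * #X ≤ ∑ σ ∈ X, (genObjective C σ - m) := by
  obtain ⟨a, b, c, d, hX⟩ := exists_class_coeffs (show 4 ≤ n by omega) C
  obtain ⟨hβ0, hβ1, hβ2, hβ⟩ := beta_spec hk hkn
  have hk0 : (0 : ℝ) < k := by exact_mod_cast (show 0 < k by omega)
  have hfac : (n.factorial : ℝ) ≠ 0 := by positivity
  set β := beta n k
  set v : ℝ → ℝ → ℝ := fun p q => a + b * p + c * p ^ 2 + d * q - m with hv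
  have hv1 : genObjective C 1 - m = v n n := by
    have h := hX {1} (by simp)
    simp only [Finset.sum_singleton] at h
    rw [h]
    simp [hv, fixCount, invCount]
  have hv0 : a + b + 2 * c + 2 * d - m = 0 := by
    have h := hX univ (by simp)
    rw [Finset.sum_sub_distrib, h] at hm
    simp only [Finset.sum_add_distrib, ← Finset.mul_sum, sum_fixCount (show 1 ≤ n by omega),
      sum_fixCount_sq (show 2 ≤ n by omega), sum_invCount (show 2 ≤ n by omega),
      Finset.sum_const, card_univ, Fintype.card_perm, Fintype.card_fin, nsmul_eq_mul] at hm
    refine (mul_eq_zero.1 (?_ : (n.factorial : ℝ) * _ = 0)).resolve_left hfac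
    linarith
  have hclass : ∀ p q : ℕ, ∑ σ ∈ countClass n p q, (genObjective C σ - m) =
      #(countClass n p q) * v p q := by
    intro p q
    rw [← sum_countClass, Finset.sum_sub_distrib, hX _ conj_mem_countClass,
      ← Finset.sum_sub_distrib]
  have hk6 : 6 ≤ k.factorial := Nat.factorial_le hk
  suffices h : β * v n n ≤ v k k ∨ β * v n n ≤ v 0 0 ∨ β * v n n ≤ v 0 2 by
    rw [hv1]
    rcases h with h | h | h
    · refine ⟨countClass n k k, factorial_le_card_countClass_self (by omega), ?_⟩
      rw [hclass, mul_comm]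
      exact mul_le_mul_of_nonneg_left h (Nat.cast_nonneg _)
    · refine ⟨countClass n 0 0, ?_, ?_⟩
      · have := factorial_le_card_countClass_self (n := n) (k := 0) (by omega)
        rw [Nat.factorial_zero] at this
        exact this.trans (Nat.mul_le_mul_right _ (by omega))
      · rw [hclass, mul_comm]
        exact mul_le_mul_of_nonneg_left (by exact_mod_cast h) (Nat.cast_nonneg _)
    · refine ⟨countClass n 0 2, ?_, ?_⟩
      · exact (factorial_le_card_countClass_two (by omega)).trans
          (Nat.mul_le_mul_right _ (by omega))
      · rw [hclass, mul_comm]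
        exact mul_le_mul_of_nonneg_left (by exact_mod_cast h) (Nat.cast_nonneg _)
  by_contra! hcon
  obtain ⟨h1, h2, h3⟩ := hcon
  -- Weights `w`, `(1 + β)/2 - w`, `(1 - β)/2` sum to 1. Only the class `(k, k)` has fixed points,
  -- so matching the mean of `p` forces `w`; matching `q` then forces the weight of `(0, 2)`.
  set w : ℝ := (1 + β * (n - 1)) / k with hw
  have hwk : w * k = 1 + β * (n - 1) := div_mul_cancel₀ _ hk0.ne'
  have hwk2 : w * k ^ 2 = 2 + β * (n ^ 2 - 2) := by
    rw [sq, ← mul_assoc, hwk]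
    linarith
  have hw0 : 0 ≤ (1 + β) / 2 - w := by
    rw [hw, sub_nonneg, div_le_iff₀ hk0]
    linarith
  have hwpos : 0 < w := by
    refine div_pos ?_ hk0
    have : (1 : ℝ) ≤ n := by exact_mod_cast (show 1 ≤ n by omega)
    nlinarith
  have hcomb : w * v k k + ((1 + β) / 2 - w) * v 0 0 + (1 - β) / 2 * v 0 2 = β * v n n := by
    simp only [hv]
    linear_combination b * hwk + c * hwk2 + d * hwk + (1 - β) * hv0
  have := mul_lt_mul_of_pos_left h1 hwpos
  have := mul_le_mul_of_nonneg_left h2.le hw0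
  have := mul_le_mul_of_nonneg_left h3.le (show 0 ≤ (1 - β) / 2 by linarith)
  linarith

end QAP

theorem theorem5p1 (n : ℕ) (f : Equiv.Perm (Fin n) → ℝ)
    (hf : (∃ A B : Matrix (Fin n) (Fin n) ℝ, f = QAP.objective A B) ∨
      (∃ C : Fin n → Fin n → Fin n → Fin n → ℝ, f = QAP.genObjective C))
    (τ : Equiv.Perm (Fin n)) (hτ : ∀ σ, QAP.shifted f σ ≤ QAP.shifted f τ)
    (k : ℕ) (hk : 3 ≤ k) (hkn : k + 5 ≤ n)
    (γ : ℝ) (hγ0 : 0 < γ) (hγ1 : γ < 1) :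
    (1 - γ) * QAP.beta n k / (5 * (k.factorial : ℝ)) ≤
      QAP.prob {σ | γ * QAP.beta n k * QAP.shifted f τ ≤ QAP.shifted f σ} := by
  classical
  obtain ⟨C, rfl⟩ : ∃ C, f = QAP.genObjective C := by
    rcases hf with ⟨A, B, rfl⟩ | h
    · exact ⟨_, QAP.objective_eq_genObjective A B⟩
    · exact h
  set f := QAP.genObjective C
  -- Translating by `τ` is absorbed into the coefficients and preserves the uniform distribution.
  obtain ⟨hβ0, hβ1, -, -⟩ := QAP.beta_spec hk hkn
  set C' : Fin n → Fin n → Fin n → Fin n → ℝ := fun i j u v => C i j (τ u) (τ v)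
  have hC' : ∀ σ, QAP.shifted f (τ * σ) = QAP.genObjective C' σ - QAP.average f := fun _ => rfl
  have hsum : ∑ σ, QAP.shifted f (τ * σ) = 0 := by
    rw [← QAP.sum_shifted f]
    exact Equiv.sum_comp (Equiv.mulLeft τ) (QAP.shifted f)
  have hM : 0 ≤ QAP.shifted f τ := by
    by_contra! hneg
    have := Finset.sum_neg (s := Finset.univ) (f := QAP.shifted f)
      (fun σ _ => (hτ σ).trans_lt hneg) Finset.univ_nonempty
    exact this.ne (QAP.sum_shifted f)
  obtain ⟨X, hX, havg⟩ := QAP.exists_class_average hk hkn C' (QAP.average f) hsum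
  rw [← hC' 1, mul_one] at havg
  have hcount := QAP.mul_card_le_card_filter X (fun σ => QAP.shifted f (τ * σ)) hM
    (fun σ => hτ _) hβ0.le hβ1.le hγ0.le havg
  have hcard : (Finset.univ.filter fun σ =>
      γ * QAP.beta n k * QAP.shifted f τ ≤ QAP.shifted f (τ * σ)).card =
      (Finset.univ.filter fun σ =>
        γ * QAP.beta n k * QAP.shifted f τ ≤ QAP.shifted f σ).card :=
    Finset.card_equiv (Equiv.mulLeft τ) fun σ => by simp
  rw [hcard] at hcount
  rw [QAP.prob_eq, div_le_div_iff₀ (by positivity) (by positivity)]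
  have hXr : (n.factorial : ℝ) ≤ 5 * k.factorial * X.card := by exact_mod_cast hX
  have hpos : 0 ≤ (1 - γ) * QAP.beta n k := mul_nonneg (by linarith) hβ0.le
  calc (1 - γ) * QAP.beta n k * n.factorial
      ≤ (1 - γ) * QAP.beta n k * (5 * k.factorial * X.card) :=
        mul_le_mul_of_nonneg_left hXr hpos
    _ = ((1 - γ) * QAP.beta n k * X.card) * (5 * k.factorial) := by ring
    _ ≤ _ := mul_le_mul_of_nonneg_right hcount (by positivity)
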